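/- Let $N,d,w\ge 1$ be integers, and let $p_1\ge p_2\ge\dots\ge p_N\ge 0$ with $\sum_{j=1}^N p_j=1$. Let the requests $Z(1),Z(2),\dots$ be i.i.d. with $\Pr(Z(s)=j)=p_j$ for $j\in I=\{1,\dots,N\}$, and let $n_i(t)=|\{1\le s\le t: Z(s)=i\}|$. Let $h_1,\dots,h_d: I\to\{1,\dots,w\}$ be drawn independently of each other and of the requests, each uniformly at random from a finite pairwise independent family of hash functions, that is, a family such that a uniformly chosen member $h$ satisfies $\Pr(h(x)=a,\,h(y)=b)=1/w^2$ for all items $x\ne y$ and all values $a,b$. The Count-Min sketch with conservative updates (CMS-CU) keeps $d$ rows of $w$ counters, all initially $0$. Let $c_j^r(t)$ be the value, after $t$ requests, of counter $h_r(j)$ of row $r$. When item $j$ is requested at time $t$, the counter $h_r(j)$ of each row $r$ is set to $\max\bigl(c_j^r(t-1),\ \min_{1\le f\le d}c_j^f(t-1)+1\bigr)$, and all other counters are unchanged. The estimation error of item $i$ is $e_i(t)=\min_{1\le r\le d}c_i^r(t)-n_i(t)$. For real $x\neq 0$ put $$\mathcal A(x)=\min_{0\le k\le w-1}\left(\frac{\sum_{j>k}p_j}{(w-k)\,x}+\frac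 kw\right),\qquad \mathcal A(0)=1,$$ and let $\gamma_{i,j}=1$ for $j\le i$ and $\gamma_{i,j}=\min\bigl(\mathcal A(p_i-p_j)^{d-1},1\bigr)$ for $j>i$. Then for every item $i$ there is a constant $B_i>0$, independent of $t$, such that for all $t\ge 1$ $$\mathbb E\!\left[\frac{e_i(t)}{t}\right]\le \frac1w\sum_{j\ne i}p_j\,\gamma_{i,j}+\frac{B_i}{t}.$$ -/

import Mathlib

open MeasureTheory ProbabilityTheory

namespace CMSCU

/-- A finite family `F` of hash functions, indexed by seeds `κ : K`, from `N` items to `w` values is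
pairwise independent: for a uniformly chosen seed, the pair of hash values of any two distinct items
is uniform on pairs of values. -/
def IsPairwiseIndependent {N w : ℕ} {K : Type*} [Fintype K] (F : K → Fin N → Fin w) : Prop :=
  ∀ x y : Fin N, x ≠ y → ∀ a b : Fin w,
    ((Finset.univ.filter fun κ : K => F κ x = a ∧ F κ y = b).card : ℝ) / (Fintype.card K : ℝ)
      = 1 / (w : ℝ) ^ 2

/-- The estimate of the count of item `j` read from the counter array `c` (`d` rows of `w`
counters): the minimum over the rows of the counter to which `j` is mapped. -/
noncomputable def estimate {N d w : ℕ} (h : Fin d → Fin N → Fin w) (c : Fin d → Fin w → ℕ)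
    (j : Fin N) : ℕ :=
  ⨅ f : Fin d, c f (h f j)

/-- Conservative update of the counter array when item `j` is requested. -/
noncomputable def update {N d w : ℕ} (h : Fin d → Fin N → Fin w) (c : Fin d → Fin w → ℕ)
    (j : Fin N) : Fin d → Fin w → ℕ :=
  fun r b => if b = h r j then max (c r b) (estimate h c j + 1) else c r b

/-- The counter array after the first `t` requests `z 0, …, z (t - 1)`, starting from zero. -/
noncomputable def counters {N d w : ℕ} (h : Fin d → Fin N → Fin w) (z : ℕ → Fin N) :
    ℕ → Fin d → Fin w → ℕ
  | 0 => fun _ _ => 0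
  | t + 1 => update h (counters h z t) (z t)

/-- The number of occurrences of item `i` among the first `t` requests. -/
def count {N : ℕ} (z : ℕ → Fin N) (i : Fin N) (t : ℕ) : ℕ :=
  ((Finset.range t).filter fun s => z s = i).card

/-- The estimation error `e_i(t)`: estimate minus true count, after `t` requests. -/
noncomputable def error {N d w : ℕ} (h : Fin d → Fin N → Fin w) (z : ℕ → Fin N) (i : Fin N)
    (t : ℕ) : ℝ :=
  (estimate h (counters h z t) i : ℝ) - (count z i t : ℝ)

/-- `A_k(x) = (∑_{j > k} p_j) / ((w - k) x) + k / w`. The item `j : Fin N` has rank `j + 1`. -/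
noncomputable def Ak {N : ℕ} (w : ℕ) (p : Fin N → ℝ) (k : ℕ) (x : ℝ) : ℝ :=
  (∑ j ∈ Finset.univ.filter (fun j : Fin N => k < (j : ℕ) + 1), p j) / (((w : ℝ) - (k : ℝ)) * x)
    + (k : ℝ) / (w : ℝ)

open Classical in
/-- `A(x) = min_{k = 0, …, w - 1} A_k(x)`, with `A(0) = 1`. -/
noncomputable def A {N : ℕ} (w : ℕ) (p : Fin N → ℝ) (x : ℝ) : ℝ :=
  if x = 0 then 1 else ⨅ k : Fin w, Ak w p (k : ℕ) x

/-- `γ_{i,j}`, equal to `1` for `j ≤ i` and to `min (A(p_i - p_j)^(d-1), 1)` for `j > i`. -/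
noncomputable def gamma {N : ℕ} (d w : ℕ) (p : Fin N → ℝ) (i j : Fin N) : ℝ :=
  if j ≤ i then 1 else min (A w p (p i - p j) ^ (d - 1)) 1

end CMSCU

namespace CMSCU

/-! ### Pathwise bounds for fixed hash functions and requests -/

section Deterministic

variable {N d w : ℕ} (h : Fin d → Fin N → Fin w) (z : ℕ → Fin N)

/-! Fix one row `r`. A counter of `i` there outgrows `n_i` only when some `j ≠ i` sharing it is
requested while the estimate of `j` is at least `n_i` (`counters_le_count_add`). Such an estimate
forces, in every row, the bucket of `j` to have received at least `n_i` requests. If some bucket of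
`j` in a row other than `r` has popularity below `p i`, this is a large deviation: by Hoeffding its
probability decays geometrically in time, so summing over time and over the finitely many light sets
costs a constant (`measureReal_count_le_sum_count_le`). Otherwise the bucket of `j` is heavy in all
`d - 1` other rows, an event of the hashes alone. Independence of the rows gives `1 / w` for the
collision in `r` times the `(d - 1)`-th power of the heavy-bucket probability
(`measureReal_collision_le`), which a union bound plus Markov controls by `A` (`load_le_A`). -/

theorem count_succ (i : Fin N) (t : ℕ) :
    count z i (t + 1) = count z i t + if z t = i then 1 else 0 := by
  unfold count
  rw [Finset.range_add_one, Finset.filter_insert]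
  split_ifs
  · rw [Finset.card_insert_of_notMem (by simp)]
  · rfl

theorem count_le (i : Fin N) (t : ℕ) : count z i t ≤ t :=
  (Finset.card_filter_le _ _).trans_eq (Finset.card_range t)

theorem estimate_le (c : Fin d → Fin w → ℕ) (r : Fin d) (j : Fin N) :
    estimate h c j ≤ c r (h r j) :=
  ciInf_le (OrderBot.bddBelow _) r

/-- Every counter of an item dominates its number of occurrences. -/
theorem count_le_counters (i : Fin N) (t : ℕ) (r : Fin d) :
    count z i t ≤ counters h z t r (h r i) := by
  induction t generalizing r with
  | zero => simp [count]
  | succ t ih =>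
    have hest : count z i t ≤ estimate h (counters h z t) i := by
      have : Nonempty (Fin d) := ⟨r⟩
      exact le_ciInf ih
    have := ih r
    rw [count_succ, counters, update]
    by_cases hz : z t = i
    · subst hz
      simp only [if_true]
      exact le_max_of_le_right (by omega)
    · simp only [hz, if_false]
      split_ifs
      · exact le_max_of_le_left this
      · exact this

/-- A counter is at most the number of requests for the items mapped to it. -/
theorem counters_le_sum_count (t : ℕ) (r : Fin d) (b : Fin w) :
    counters h z t r b ≤ ∑ l ∈ Finset.univ.filter (fun l => h r l = b), count z l t := by
  induction t with
  | zero => simp [counters]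
  | succ t ih =>
    simp only [count_succ, Finset.sum_add_distrib, Finset.sum_ite_eq, Finset.mem_filter,
      Finset.mem_univ, true_and]
    rw [counters, update]
    have := estimate_le h (counters h z t) r (z t)
    by_cases hb : b = h r (z t)
    · subst hb
      simp only [if_true]
      omega
    · simp only [hb, Ne.symm hb, if_false]
      omega

theorem counters_le (t : ℕ) (r : Fin d) (b : Fin w) : counters h z t r b ≤ t := by
  induction t with
  | zero => simp [counters]
  | succ t ih =>
    rw [counters, update]
    have := estimate_le h (counters h z t) r (z t)
    split_ifs with hb
    · subst hb; omega
    · omega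

/-- A counter of item `i` exceeds the count of `i` by at most the number of requests for colliding
items whose estimate was at least the count of `i`. -/
theorem counters_le_count_add (i : Fin N) (t : ℕ) (r : Fin d) :
    counters h z t r (h r i) ≤ count z i t + ∑ s ∈ Finset.range t,
      if z s ≠ i ∧ h r (z s) = h r i ∧ count z i s ≤ estimate h (counters h z s) (z s)
        then 1 else 0 := by
  induction t with
  | zero => simp [counters]
  | succ t ih =>
    rw [Finset.sum_range_succ, count_succ, counters, update]
    have h1 := estimate_le h (counters h z t) r (z t)
    have h2 := count_le_counters h z i t r
    simp only [ne_eq] at ih ⊢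
    by_cases hb : h r i = h r (z t)
    · rw [← hb] at h1 ⊢
      simp only [if_true, true_and]
      by_cases hz : z t = i
      · simp only [hz, if_true]
        rw [hz] at h1
        omega
      -- If the estimate is below the count of `i`, the proposed value is at most that count, hence
      -- at most the counter, and the update changes nothing.
      · by_cases hc : count z i t ≤ estimate h (counters h z t) (z t)
        · simp only [hz, hc, if_true, if_false, not_false_eq_true, and_self]
          omega
        · omega
    · simp only [hb, if_false]
      omega

/-- Domination of the error by collision indicators that involve the hash functions only, up to
the times at which some set of items of total popularity less than `p i` has been requested at
least as often as `i`. -/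
theorem error_le (p : Fin N → ℝ) (i : Fin N) (t : ℕ) (r : Fin d) :
    error h z i t ≤ ∑ s ∈ Finset.range t,
      ((∑ j ∈ Finset.univ.erase i,
        if z s = j ∧ h r j = h r i ∧
            ∀ f, f ≠ r → p i ≤ ∑ l ∈ Finset.univ.filter (fun l => h f l = h f j), p l
          then (1 : ℝ) else 0)
      + ∑ T ∈ Finset.univ.filter (fun T : Finset (Fin N) => ∑ l ∈ T, p l < p i),
        if count z i s ≤ ∑ l ∈ T, count z l s then (1 : ℝ) else 0) := by
  have h1 : (estimate h (counters h z t) i : ℝ) ≤ count z i t + ∑ s ∈ Finset.range t,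
      if z s ≠ i ∧ h r (z s) = h r i ∧ count z i s ≤ estimate h (counters h z s) (z s)
        then (1 : ℝ) else 0 := by
    have := (estimate_le h (counters h z t) r i).trans (counters_le_count_add h z i t r)
    exact_mod_cast this
  rw [error, sub_le_iff_le_add']
  refine h1.trans (add_le_add le_rfl (Finset.sum_le_sum fun s _ => ?_))
  have hA : (0 : ℝ) ≤ ∑ j ∈ Finset.univ.erase i,
        if z s = j ∧ h r j = h r i ∧
            ∀ f, f ≠ r → p i ≤ ∑ l ∈ Finset.univ.filter (fun l => h f l = h f j), p l
          then (1 : ℝ) else 0 :=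
    Finset.sum_nonneg fun j _ => by split_ifs <;> norm_num
  have hB : (0 : ℝ) ≤ ∑ T ∈ Finset.univ.filter (fun T : Finset (Fin N) => ∑ l ∈ T, p l < p i),
        if count z i s ≤ ∑ l ∈ T, count z l s then (1 : ℝ) else 0 :=
    Finset.sum_nonneg fun T _ => by split_ifs <;> norm_num
  split_ifs with hs
  swap
  · exact add_nonneg hA hB
  obtain ⟨hzi, hcol, hest⟩ := hs
  by_cases hgood : ∀ f, f ≠ r →
      p i ≤ ∑ l ∈ Finset.univ.filter (fun l => h f l = h f (z s)), p l
  · refine le_add_of_le_of_nonneg ?_ hB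
    refine le_trans ?_ (Finset.single_le_sum (fun j _ => by split_ifs <;> norm_num)
      (Finset.mem_erase.2 ⟨hzi, Finset.mem_univ (z s)⟩))
    rw [if_pos ⟨rfl, hcol, hgood⟩]
  -- Here the witness `T` is the light bucket of `z s` in row `f`.
  · push Not at hgood
    obtain ⟨f, -, hf⟩ := hgood
    refine le_add_of_nonneg_of_le hA ?_
    refine le_trans ?_ (Finset.single_le_sum (fun T _ => by split_ifs <;> norm_num)
      (Finset.mem_filter.2 ⟨Finset.mem_univ _, hf⟩))
    rw [if_pos]
    exact hest.trans ((estimate_le h _ f _).trans (counters_le_sum_count h z s f _))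

/-- Boundedness gives integrability of the error. -/
theorem abs_error_le (hd : 1 ≤ d) (i : Fin N) (t : ℕ) : |error h z i t| ≤ t := by
  have h1 : (estimate h (counters h z t) i : ℝ) ≤ t := by
    exact_mod_cast (estimate_le h _ ⟨0, hd⟩ i).trans (counters_le h z t _ _)
  have h2 : (count z i t : ℝ) ≤ t := by exact_mod_cast count_le z i t
  have h3 : (0 : ℝ) ≤ estimate h (counters h z t) i := Nat.cast_nonneg _
  have h4 : (0 : ℝ) ≤ count z i t := Nat.cast_nonneg _
  rw [error, abs_le]
  constructor <;> linarith

end Deterministic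

/-! ### Collisions and bucket loads for a single hash function -/

section HashFamily

variable {N w : ℕ} {K : Type*} [Fintype K] {F : K → Fin N → Fin w}

/-- Two distinct items collide with probability `1 / w`. -/
theorem IsPairwiseIndependent.collision (hw : 1 ≤ w) (hF : IsPairwiseIndependent F)
    {x y : Fin N} (hxy : x ≠ y) :
    ((Finset.univ.filter fun κ => F κ x = F κ y).card : ℝ) / (Fintype.card K : ℝ)
      = 1 / (w : ℝ) := by
  have hcard : (Finset.univ.filter fun κ => F κ x = F κ y).card
      = ∑ a : Fin w, (Finset.univ.filter fun κ => F κ x = a ∧ F κ y = a).card := by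
    rw [Finset.card_eq_sum_card_fiberwise (f := fun κ => F κ x) (t := Finset.univ)
      (fun _ _ => Finset.mem_coe.2 (Finset.mem_univ _))]
    refine Finset.sum_congr rfl fun a _ => ?_
    rw [Finset.filter_filter]
    congr 1
    ext κ
    simp only [Finset.mem_filter, Finset.mem_univ, true_and]
    constructor
    · rintro ⟨h1, h2⟩
      exact ⟨h2, h1 ▸ h2⟩
    · rintro ⟨h1, h2⟩
      exact ⟨h1.trans h2.symm, h1⟩
  have hw' : (w : ℝ) ≠ 0 := by positivity
  rw [hcard]
  push_cast
  rw [Finset.sum_div, Finset.sum_congr rfl fun a _ => hF x y hxy a a]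
  simp only [Finset.sum_const, Finset.card_univ, Fintype.card_fin, nsmul_eq_mul]
  field_simp

/-- The probability that the items colliding with `j` (itself included) have total popularity at
least `x + p j`. -/
theorem IsPairwiseIndependent.load_le_Ak (hw : 1 ≤ w) (hF : IsPairwiseIndependent F)
    (p : Fin N → ℝ) (hp0 : ∀ l, 0 ≤ p l) (j : Fin N) {x : ℝ} (hx : 0 < x) {k : ℕ} (hk : k < w) :
    ((Finset.univ.filter fun κ =>
        x + p j ≤ ∑ l ∈ Finset.univ.filter (fun l => F κ l = F κ j), p l).card : ℝ)
      / (Fintype.card K : ℝ) ≤ Ak w p k x := by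
  -- `L` holds the first `k` items, treated by a union bound; `R` holds the tail, treated by Markov.
  -- Indices are zero-based, so `k < l + 1` means `k ≤ l`.
  set L : Finset (Fin N) := Finset.univ.filter fun l => (l : ℕ) < k ∧ l ≠ j
  set R : Finset (Fin N) := Finset.univ.filter fun l => k < (l : ℕ) + 1 ∧ l ≠ j
  have hkw : (k : ℝ) < w := by exact_mod_cast hk
  have hw0 : (0 : ℝ) < w := by positivity
  have hpt : ∀ κ : K,
      (if x + p j ≤ ∑ l ∈ Finset.univ.filter (fun l => F κ l = F κ j), p l then (1 : ℝ) else 0)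
      ≤ (∑ l ∈ L, if F κ l = F κ j then (1 : ℝ) else 0)
        + ∑ l ∈ R, p l / x * if F κ l = F κ j then (1 : ℝ) else 0 := by
    intro κ
    have hL : (0 : ℝ) ≤ ∑ l ∈ L, if F κ l = F κ j then (1 : ℝ) else 0 :=
      Finset.sum_nonneg fun l _ => by split_ifs <;> norm_num
    have hR : (0 : ℝ) ≤ ∑ l ∈ R, p l / x * if F κ l = F κ j then (1 : ℝ) else 0 :=
      Finset.sum_nonneg fun l _ =>
        mul_nonneg (div_nonneg (hp0 l) hx.le) (by split_ifs <;> norm_num)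
    split_ifs with hload
    swap
    · exact add_nonneg hL hR
    by_cases hc : ∃ l ∈ L, F κ l = F κ j
    · obtain ⟨l, hl, hlc⟩ := hc
      refine le_add_of_le_of_nonneg ?_ hR
      refine le_trans ?_ (Finset.single_le_sum (fun l _ => by split_ifs <;> norm_num) hl)
      rw [if_pos hlc]
    -- With no collision in `L`, the excess load `x` comes entirely from `R`.
    · push Not at hc
      refine le_add_of_nonneg_of_le hL ?_
      have hsub : ∑ l ∈ Finset.univ.filter (fun l => F κ l = F κ j), p l
          ≤ p j + ∑ l ∈ R, p l * if F κ l = F κ j then (1 : ℝ) else 0 := by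
        rw [Finset.sum_filter, ← Finset.add_sum_erase _ _ (Finset.mem_univ j), if_pos rfl]
        refine add_le_add le_rfl (le_of_eq ?_)
        refine (Finset.sum_subset_zero_on_sdiff (fun l hl => ?_) (fun l hl => ?_) ?_).symm
        · exact Finset.mem_erase.2 ⟨(Finset.mem_filter.1 hl).2.2, Finset.mem_univ _⟩
        · rw [Finset.mem_sdiff, Finset.mem_erase, Finset.mem_filter] at hl
          refine if_neg (hc l (Finset.mem_filter.2 ⟨Finset.mem_univ _, ?_, hl.1.1⟩))
          by_contra hlk
          exact hl.2 ⟨Finset.mem_univ _, by omega, hl.1.1⟩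
        · intro l _
          simp
      simp_rw [div_mul_eq_mul_div]
      rw [← Finset.sum_div, le_div_iff₀ hx]
      linarith
  have hcol : ∀ l, l ≠ j → (∑ κ : K, if F κ l = F κ j then (1 : ℝ) else 0) / Fintype.card K
      = 1 / w := by
    intro l hl
    rw [Finset.sum_boole]
    exact hF.collision hw hl
  have hLcard : (L.card : ℝ) ≤ k := by
    have : L.card ≤ (Finset.range k).card :=
      Finset.card_le_card_of_injOn (fun l => (l : ℕ))
        (fun l hl => by simpa using (Finset.mem_filter.1 hl).2.1)
        (fun a _ b _ hab => Fin.ext hab)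
    rw [Finset.card_range] at this
    exact_mod_cast this
  have hRsum : ∑ l ∈ R, p l ≤ ∑ l ∈ Finset.univ.filter (fun l : Fin N => k < (l : ℕ) + 1), p l :=
    Finset.sum_le_sum_of_subset_of_nonneg
      (fun l hl => Finset.mem_filter.2 ⟨Finset.mem_univ _, (Finset.mem_filter.1 hl).2.1⟩)
      (fun l _ _ => hp0 l)
  calc _ = (∑ κ : K, if x + p j ≤ ∑ l ∈ Finset.univ.filter (fun l => F κ l = F κ j), p l
            then (1 : ℝ) else 0) / Fintype.card K := by rw [Finset.sum_boole]
    _ ≤ (∑ κ : K, ((∑ l ∈ L, if F κ l = F κ j then (1 : ℝ) else 0)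
        + ∑ l ∈ R, p l / x * if F κ l = F κ j then (1 : ℝ) else 0)) / Fintype.card K := by
        gcongr with κ; exact hpt κ
    _ = (∑ l ∈ L, (1 : ℝ) / w) + ∑ l ∈ R, p l / x * (1 / w) := by
        rw [Finset.sum_add_distrib, Finset.sum_comm, Finset.sum_comm (t := R), add_div,
          Finset.sum_div, Finset.sum_div]
        congr 1
        · exact Finset.sum_congr rfl fun l hl => hcol l (Finset.mem_filter.1 hl).2.2
        · refine Finset.sum_congr rfl fun l hl => ?_
          rw [← Finset.mul_sum, mul_div_assoc, hcol l (Finset.mem_filter.1 hl).2.2]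
    _ = L.card / w + (∑ l ∈ R, p l) / (w * x) := by
        rw [Finset.sum_const, nsmul_eq_mul, mul_one_div, Finset.sum_div]
        congr 1
        refine Finset.sum_congr rfl fun l _ => ?_
        rw [div_mul_div_comm, mul_one, mul_comm]
    -- The argument yields the denominator `w * x`; it is weakened to `(w - k) * x` to match `Ak`.
    _ ≤ k / w + (∑ l ∈ Finset.univ.filter (fun l : Fin N => k < (l : ℕ) + 1), p l)
          / ((w - k) * x) := by
        refine add_le_add (div_le_div_of_nonneg_right hLcard hw0.le) ?_
        refine div_le_div₀ (Finset.sum_nonneg fun l _ => hp0 l) hRsum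
          (mul_pos (by linarith) hx) ?_
        exact mul_le_mul_of_nonneg_right (by linarith [(Nat.cast_nonneg k : (0 : ℝ) ≤ k)]) hx.le
    _ = Ak w p k x := by rw [Ak, add_comm]

theorem IsPairwiseIndependent.load_le_A (hw : 1 ≤ w) (hF : IsPairwiseIndependent F)
    (p : Fin N → ℝ) (hp0 : ∀ l, 0 ≤ p l) (j : Fin N) {x : ℝ} (hx : 0 ≤ x) :
    ((Finset.univ.filter fun κ =>
        x + p j ≤ ∑ l ∈ Finset.univ.filter (fun l => F κ l = F κ j), p l).card : ℝ)
      / (Fintype.card K : ℝ) ≤ A w p x := by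
  unfold A
  split_ifs with h0
  · refine div_le_one_of_le₀ ?_ (Nat.cast_nonneg _)
    exact_mod_cast Finset.card_le_univ _
  · have : Nonempty (Fin w) := ⟨⟨0, hw⟩⟩
    exact le_ciInf fun k => hF.load_le_Ak hw p hp0 j (lt_of_le_of_ne hx (Ne.symm h0)) k.2

end HashFamily

/-! ### Measurability, large deviations, and independence across rows -/

section Probability

variable {N d w : ℕ} {Ω : Type*} [MeasurableSpace Ω] {μ : Measure Ω}

theorem measurable_count {Z : ℕ → Ω → Fin N} (hZ_meas : ∀ s, Measurable (Z s)) (i : Fin N) (t : ℕ) :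
    Measurable fun ω => count (fun s => Z s ω) i t := by
  induction t with
  | zero => simp [count]
  | succ t ih =>
    simp only [count_succ]
    exact ih.add (Measurable.ite (measurableSet_eq_fun (hZ_meas t) measurable_const)
      measurable_const measurable_const)

theorem measurable_counters {h : Ω → Fin d → Fin N → Fin w} (hh : Measurable h)
    {Z : ℕ → Ω → Fin N} (hZ_meas : ∀ s, Measurable (Z s)) (t : ℕ) :
    Measurable fun ω => counters (h ω) (fun s => Z s ω) t := by
  induction t with
  | zero => exact measurable_const
  | succ t ih =>
    -- The domain is countable and discrete, so measurability is automatic.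
    have hup : Measurable fun q : (Fin d → Fin N → Fin w) × (Fin d → Fin w → ℕ) × Fin N =>
        update q.1 q.2.1 q.2.2 := Measurable.of_discrete
    exact hup.comp (hh.prodMk (ih.prodMk (hZ_meas t)))

theorem measurable_error {h : Ω → Fin d → Fin N → Fin w} (hh : Measurable h)
    {Z : ℕ → Ω → Fin N} (hZ_meas : ∀ s, Measurable (Z s)) (i : Fin N) (t : ℕ) :
    Measurable fun ω => error (h ω) (fun s => Z s ω) i t := by
  have hest : Measurable fun q : (Fin d → Fin N → Fin w) × (Fin d → Fin w → ℕ) =>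
      (estimate q.1 q.2 i : ℝ) := Measurable.of_discrete
  have hcast : Measurable fun n : ℕ => (n : ℝ) := Measurable.of_discrete
  exact (hest.comp (hh.prodMk (measurable_counters hh hZ_meas t))).sub
    (hcast.comp (measurable_count hZ_meas i t))

/-- A set of items of total popularity less than that of `i` is exponentially unlikely to be
requested as often as `i`. -/
theorem measureReal_count_le_sum_count_le [IsProbabilityMeasure μ] {p : Fin N → ℝ}
    {Z : ℕ → Ω → Fin N} (hZ_meas : ∀ s, Measurable (Z s))
    (hZ_law : ∀ s j, μ.real {ω | Z s ω = j} = p j) (hZ_indep : iIndepFun Z μ)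
    (i : Fin N) (T : Finset (Fin N)) (hT : ∑ l ∈ T, p l ≤ p i) (s : ℕ) :
    μ.real {ω | count (fun s => Z s ω) i s ≤ ∑ l ∈ T, count (fun s => Z s ω) l s}
      ≤ Real.exp (-(p i - ∑ l ∈ T, p l) ^ 2 / 2) ^ s := by
  set δ := p i - ∑ l ∈ T, p l with hδ
  -- Increment of the random walk `n_T - n_i`: it has drift `-δ` and values in `[-1, 1]`, hence
  -- variance proxy `1`.
  set g : Fin N → ℝ := fun m => (if m ∈ T then 1 else 0) - if m = i then 1 else 0 with hg
  have hgm : Measurable g := Measurable.of_discrete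
  have hmean : ∀ m, ∫ ω, g (Z m ω) ∂μ = -δ := by
    intro m
    have hfun : ∀ l, (fun ω => if Z m ω = l then (1 : ℝ) else 0)
        = {ω | Z m ω = l}.indicator 1 := by
      intro l
      ext ω
      simp only [Set.indicator_apply, Set.mem_ofPred_eq, Pi.one_apply]
    have hind : ∀ l, ∫ ω, (if Z m ω = l then (1 : ℝ) else 0) ∂μ = p l := by
      intro l
      rw [hfun, integral_indicator_one (measurableSet_eq_fun (hZ_meas m) measurable_const),
        hZ_law m l]
    have hint : ∀ l, Integrable (fun ω => if Z m ω = l then (1 : ℝ) else 0) μ := fun l => by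
      rw [hfun]
      exact (integrable_const (1 : ℝ)).indicator (measurableSet_eq_fun (hZ_meas m) measurable_const)
    have hg' : ∀ ω, g (Z m ω)
        = (∑ l ∈ T, if Z m ω = l then (1 : ℝ) else 0) - if Z m ω = i then 1 else 0 := by
      intro ω
      simp only [hg, Finset.sum_ite_eq]
    simp_rw [hg']
    rw [integral_sub (integrable_finsetSum _ fun l _ => hint l) (hint i),
      integral_finsetSum _ fun l _ => hint l, hind, Finset.sum_congr rfl fun l _ => hind l, hδ]
    ring
  have hsubG : ∀ m < s, HasSubgaussianMGF (fun ω => g (Z m ω) + δ) 1 μ := by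
    intro m _
    have := hasSubgaussianMGF_of_mem_Icc (μ := μ) (X := fun ω => g (Z m ω)) (a := -1) (b := 1)
      (hgm.comp (hZ_meas m)).aemeasurable (Filter.Eventually.of_forall fun ω => by
        simp only [hg, Set.mem_Icc]
        split_ifs <;> norm_num)
    rw [hmean m] at this
    simp only [sub_neg_eq_add] at this
    convert this using 1
    norm_num
  have hindep : iIndepFun (fun m ω => g (Z m ω) + δ) μ :=
    hZ_indep.comp (fun _ l => g l + δ) fun _ => Measurable.of_discrete
  have hδ0 : 0 ≤ δ := sub_nonneg.2 hT
  have hmain := HasSubgaussianMGF.measure_sum_range_ge_le_of_iIndepFun hindep hsubG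
    (mul_nonneg (Nat.cast_nonneg s) hδ0)
  have hset : {ω | count (fun s => Z s ω) i s ≤ ∑ l ∈ T, count (fun s => Z s ω) l s}
      = {ω | s * δ ≤ ∑ m ∈ Finset.range s, (g (Z m ω) + δ)} := by
    ext ω
    have hcount : ∀ l, (count (fun s => Z s ω) l s : ℝ)
        = ∑ m ∈ Finset.range s, if Z m ω = l then (1 : ℝ) else 0 := by
      intro l
      rw [count, Finset.sum_boole]
    have hsum : ∑ m ∈ Finset.range s, (g (Z m ω) + δ)
        = (∑ l ∈ T, (count (fun s => Z s ω) l s : ℝ)) - count (fun s => Z s ω) i s + s * δ := by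
      simp_rw [hcount]
      rw [Finset.sum_comm, Finset.sum_add_distrib, ← Finset.sum_sub_distrib]
      simp [hg]
    simp only [Set.mem_ofPred_eq]
    rw [hsum, ← Nat.cast_le (α := ℝ), Nat.cast_sum]
    constructor <;> intro <;> linarith
  rw [hset]
  refine hmain.trans (le_of_eq ?_)
  rw [← Real.exp_nat_mul]
  congr 1
  -- Hoeffding's exponent divides by `s`; at `s = 0` both sides equal `1`.
  rcases Nat.eq_zero_or_pos s with rfl | hs
  · simp
  · have : (s : ℝ) ≠ 0 := by positivity
    push_cast
    field_simp

theorem measureReal_preimage_eq_card_div {K : Type*} [Fintype K] [MeasurableSpace K]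
    [MeasurableSingletonClass K] [IsProbabilityMeasure μ] {V : Ω → K} (hV : Measurable V)
    (hunif : ∀ κ, μ.real {ω | V ω = κ} = 1 / (Fintype.card K : ℝ)) (S : Finset K) :
    μ.real (V ⁻¹' S) = S.card / (Fintype.card K : ℝ) := by
  have hpre : V ⁻¹' S = ⋃ κ ∈ S, {ω | V ω = κ} := by
    ext ω
    simp
  rw [hpre, measureReal_biUnion_finset]
  · rw [Finset.sum_congr rfl fun κ _ => hunif κ, Finset.sum_const, nsmul_eq_mul, mul_one_div]
  · intro a _ b _ hab
    exact Set.disjoint_left.2 fun ω h1 h2 => hab (h1.symm.trans h2)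
  · exact fun κ _ => hV (measurableSet_singleton κ)

/-- The probability that `j` collides with `i` in row `r` while, in every other row, the items
colliding with `j` have total popularity at least `p i`. -/
theorem measureReal_collision_le [IsProbabilityMeasure μ] (hw : 1 ≤ w)
    {K : Type*} [Fintype K] [Nonempty K] [MeasurableSpace K] [MeasurableSingletonClass K]
    {F : K → Fin N → Fin w} (hF : IsPairwiseIndependent F)
    {U : Fin d → Ω → K} (hU_meas : ∀ r, Measurable (U r))
    (hU_unif : ∀ r κ, μ.real {ω | U r ω = κ} = 1 / (Fintype.card K : ℝ))
    (hU_indep : iIndepFun U μ) {p : Fin N → ℝ} (hp : Antitone p) (hp0 : ∀ l, 0 ≤ p l)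
    (r : Fin d) {i j : Fin N} (hij : j ≠ i) :
    μ.real {ω | F (U r ω) j = F (U r ω) i ∧
        ∀ f, f ≠ r → p i ≤ ∑ l ∈ Finset.univ.filter (fun l => F (U f ω) l = F (U f ω) j), p l}
      ≤ 1 / w * gamma d w p i j := by
  classical
  -- Row `r` contributes the collision event `C`, every other row the heavy-bucket event `L`, so the
  -- probability factorizes.
  set C : Finset K := Finset.univ.filter fun κ => F κ j = F κ i
  set L : Finset K := Finset.univ.filter fun κ =>
    p i ≤ ∑ l ∈ Finset.univ.filter (fun l => F κ l = F κ j), p l with hL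
  have hset : {ω | F (U r ω) j = F (U r ω) i ∧
        ∀ f, f ≠ r → p i ≤ ∑ l ∈ Finset.univ.filter (fun l => F (U f ω) l = F (U f ω) j), p l}
      = ⋂ f ∈ Finset.univ, U f ⁻¹' ((if f = r then C else L : Finset K) : Set K) := by
    ext ω
    simp only [Set.mem_ofPred_eq, Set.mem_iInter, Set.mem_preimage, Finset.mem_univ, true_imp_iff]
    constructor
    · rintro ⟨h1, h2⟩ f
      split_ifs with hf
      · subst hf; simpa [C] using h1
      · simpa [L] using h2 f hf
    · intro h
      refine ⟨by simpa [C] using h r, fun f hf => by simpa [L, hf] using h f⟩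
  have hprod : μ.real (⋂ f ∈ Finset.univ, U f ⁻¹' ((if f = r then C else L : Finset K) : Set K))
      = 1 / w * ((L.card : ℝ) / Fintype.card K) ^ (d - 1) := by
    rw [measureReal_def, hU_indep.measure_inter_preimage_eq_mul Finset.univ
      (fun f _ => (Finset.finite_toSet _).measurableSet), ENNReal.toReal_prod]
    simp_rw [← measureReal_def]
    rw [Finset.prod_congr rfl fun f _ =>
        measureReal_preimage_eq_card_div (hU_meas f) (hU_unif f) _,
      ← Finset.mul_prod_erase _ _ (Finset.mem_univ r), if_pos rfl, hF.collision hw hij,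
      Finset.prod_congr rfl fun f hf => by rw [if_neg (Finset.ne_of_mem_erase hf)],
      Finset.prod_const, Finset.card_erase_of_mem (Finset.mem_univ r), Finset.card_univ,
      Fintype.card_fin]
  rw [hset, hprod]
  refine mul_le_mul_of_nonneg_left ?_ (by positivity)
  have hL0 : (0 : ℝ) ≤ L.card / Fintype.card K := by positivity
  have hL1 : (L.card : ℝ) / Fintype.card K ≤ 1 := by
    refine div_le_one_of_le₀ ?_ (Nat.cast_nonneg _)
    exact_mod_cast Finset.card_le_univ _
  unfold gamma
  split_ifs with hle
  · exact pow_le_one₀ hL0 hL1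
  · refine le_min (pow_le_pow_left₀ hL0 ?_ _) (pow_le_one₀ hL0 hL1)
    -- Since `j` lies in its own bucket, load `p i` means excess `x = p i - p j`, nonnegative by the
    -- ordering.
    have := hF.load_le_A hw p hp0 j (sub_nonneg.2 (hp (not_le.1 hle).le))
    simpa only [sub_add_cancel] using this

end Probability

end CMSCU

/-! ### Main theorem: averaging the pathwise bound -/

theorem theorem1 {N d w : ℕ} (hd : 1 ≤ d) (hw : 1 ≤ w)
    -- the popularities, in non-increasing order
    (p : Fin N → ℝ) (hp : Antitone p)
    -- the pairwise independent family of hash functions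
    {K : Type*} [Fintype K] [Nonempty K] [MeasurableSpace K] [MeasurableSingletonClass K]
    (F : K → Fin N → Fin w) (hF : CMSCU.IsPairwiseIndependent F)
    {Ω : Type*} [MeasurableSpace Ω] (μ : Measure Ω) [IsProbabilityMeasure μ]
    -- the hash function of each row is drawn independently and uniformly from the family
    (U : Fin d → Ω → K) (hU_meas : ∀ r, Measurable (U r))
    (hU_unif : ∀ r κ, μ.real {ω | U r ω = κ} = 1 / (Fintype.card K : ℝ))
    (hU_indep : iIndepFun U μ)
    -- the requests are i.i.d. with law `p`, and independent of the hash functions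
    (Z : ℕ → Ω → Fin N) (hZ_meas : ∀ s, Measurable (Z s))
    (hZ_law : ∀ s j, μ.real {ω | Z s ω = j} = p j)
    (hZ_indep : iIndepFun Z μ)
    (hUZ : IndepFun (fun ω r => U r ω) (fun ω s => Z s ω) μ)
    (i : Fin N) :
    ∃ B : ℝ, 0 < B ∧ ∀ t : ℕ, 1 ≤ t →
      Integrable (fun ω => CMSCU.error (fun r => F (U r ω)) (fun s => Z s ω) i t / (t : ℝ)) μ ∧
      ∫ ω, CMSCU.error (fun r => F (U r ω)) (fun s => Z s ω) i t / (t : ℝ) ∂μ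
        ≤ (1 / (w : ℝ)) * ∑ j ∈ Finset.univ.erase i, p j * CMSCU.gamma d w p i j
          + B / (t : ℝ) := by
  have hp0 : ∀ l, 0 ≤ p l := fun l => hZ_law 0 l ▸ measureReal_nonneg
  -- Any fixed row would do.
  let r : Fin d := ⟨0, hd⟩
  let 𝒯 : Finset (Finset (Fin N)) :=
    Finset.univ.filter fun T : Finset (Fin N) => ∑ l ∈ T, p l < p i
  let q : Finset (Fin N) → ℝ := fun T => Real.exp (-(p i - ∑ l ∈ T, p l) ^ 2 / 2)
  have hq1 : ∀ T ∈ 𝒯, q T < 1 := by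
    intro T hT
    have : 0 < p i - ∑ l ∈ T, p l := sub_pos.2 (Finset.mem_filter.1 hT).2
    exact Real.exp_lt_one_iff.2 (by have := pow_pos this 2; linarith)
  have hB0 : 0 ≤ ∑ T ∈ 𝒯, (1 - q T)⁻¹ :=
    Finset.sum_nonneg fun T hT => inv_nonneg.2 (sub_nonneg.2 (hq1 T hT).le)
  have hUm : Measurable fun ω r => U r ω := measurable_pi_lambda _ hU_meas
  have hFm : Measurable fun (u : Fin d → K) r => F (u r) := Measurable.of_discrete
  have herr : ∀ t, Measurable fun ω =>
      CMSCU.error (fun r => F (U r ω)) (fun s => Z s ω) i t := fun t =>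
    CMSCU.measurable_error (hFm.comp hUm) hZ_meas i t
  have hint : ∀ t, Integrable (fun ω =>
      CMSCU.error (fun r => F (U r ω)) (fun s => Z s ω) i t) μ := fun t =>
    Integrable.of_bound (herr t).aestronglyMeasurable t
      (Filter.Eventually.of_forall fun ω => CMSCU.abs_error_le _ _ hd i t)
  let E : Fin N → Set (Fin d → K) := fun j => {u | F (u r) j = F (u r) i ∧
    ∀ f, f ≠ r → p i ≤ ∑ l ∈ Finset.univ.filter (fun l => F (u f) l = F (u f) j), p l}
  let H : ℕ → Fin N → Set Ω := fun s j =>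
    {ω | Z s ω = j ∧ F (U r ω) j = F (U r ω) i ∧
      ∀ f, f ≠ r → p i ≤ ∑ l ∈ Finset.univ.filter (fun l => F (U f ω) l = F (U f ω) j), p l}
  let G : ℕ → Finset (Fin N) → Set Ω := fun s T =>
    {ω | CMSCU.count (fun s => Z s ω) i s ≤ ∑ l ∈ T, CMSCU.count (fun s => Z s ω) l s}
  have hH : ∀ s j, H s j = (fun ω r => U r ω) ⁻¹' E j ∩
      (fun ω s => Z s ω) ⁻¹' {z : ℕ → Fin N | z s = j} := by
    intro s j
    ext ω
    exact and_comm
  have hEm : ∀ j, MeasurableSet (E j) := fun j => (Set.toFinite _).measurableSet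
  have hzm : ∀ s j, MeasurableSet {z : ℕ → Fin N | z s = j} := fun s j =>
    measurableSet_eq_fun (measurable_pi_apply s) measurable_const
  have hHm : ∀ s j, MeasurableSet (H s j) := by
    intro s j
    rw [hH]
    exact (hUm (hEm j)).inter (measurable_pi_lambda _ hZ_meas (hzm s j))
  have hGm : ∀ s T, MeasurableSet (G s T) := fun s T =>
    measurableSet_le (CMSCU.measurable_count hZ_meas i s)
      (Finset.measurable_fun_sum _ fun l _ => CMSCU.measurable_count hZ_meas l s)
  have hHint : ∀ s j, Integrable ((H s j).indicator (1 : Ω → ℝ)) μ := fun s j =>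
    (integrable_const (1 : ℝ)).indicator (hHm s j)
  have hGint : ∀ s T, Integrable ((G s T).indicator (1 : Ω → ℝ)) μ := fun s T =>
    (integrable_const (1 : ℝ)).indicator (hGm s T)
  have hHGint : ∀ s, Integrable (fun ω =>
      (∑ j ∈ Finset.univ.erase i, (H s j).indicator (1 : Ω → ℝ) ω)
        + ∑ T ∈ 𝒯, (G s T).indicator (1 : Ω → ℝ) ω) μ := fun s =>
    (integrable_finsetSum _ fun j _ => hHint s j).add (integrable_finsetSum _ fun T _ => hGint s T)
  have hHle : ∀ s j, j ≠ i → μ.real (H s j) ≤ 1 / w * (p j * CMSCU.gamma d w p i j) := by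
    intro s j hj
    -- `E j` involves only the hashes, so it is independent of the request at time `s`.
    have hmul : μ.real (H s j) = μ.real ((fun ω r => U r ω) ⁻¹' E j) * p j := by
      rw [hH, measureReal_def, hUZ.measure_inter_preimage_eq_mul _ _ (hEm j) (hzm s j),
        ENNReal.toReal_mul, ← hZ_law s j]
      rfl
    rw [hmul]
    have := CMSCU.measureReal_collision_le hw hF hU_meas hU_unif hU_indep hp hp0 r hj
    calc _ ≤ 1 / w * CMSCU.gamma d w p i j * p j := mul_le_mul_of_nonneg_right this (hp0 j)
      _ = _ := by ring
  have hGle : ∀ t, ∀ T ∈ 𝒯, ∑ s ∈ Finset.range t, μ.real (G s T) ≤ (1 - q T)⁻¹ := by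
    intro t T hT
    refine (Finset.sum_le_sum fun s _ => CMSCU.measureReal_count_le_sum_count_le hZ_meas hZ_law
      hZ_indep i T (Finset.mem_filter.1 hT).2.le s).trans ?_
    rw [← tsum_geometric_of_lt_one (Real.exp_nonneg _) (hq1 T hT)]
    exact (summable_geometric_of_lt_one (Real.exp_nonneg _) (hq1 T hT)).sum_le_tsum _
      fun s _ => pow_nonneg (Real.exp_nonneg _) s
  -- The geometric series sum to `(1 - q T)⁻¹`; the extra `1` keeps the constant positive when `𝒯`
  -- is empty, as for `p i = 0`.
  refine ⟨1 + ∑ T ∈ 𝒯, (1 - q T)⁻¹, by linarith, fun t ht => ⟨(hint t).div_const _, ?_⟩⟩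
  have ht0 : (0 : ℝ) < t := by exact_mod_cast ht
  have hbound : ∫ ω, CMSCU.error (fun r => F (U r ω)) (fun s => Z s ω) i t ∂μ
      ≤ t * ((1 / (w : ℝ)) * ∑ j ∈ Finset.univ.erase i, p j * CMSCU.gamma d w p i j)
        + ∑ T ∈ 𝒯, (1 - q T)⁻¹ := by
    calc _ ≤ ∫ ω, ∑ s ∈ Finset.range t,
            ((∑ j ∈ Finset.univ.erase i, (H s j).indicator (1 : Ω → ℝ) ω)
              + ∑ T ∈ 𝒯, (G s T).indicator (1 : Ω → ℝ) ω) ∂μ := by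
          refine integral_mono (hint t) (integrable_finsetSum _ fun s _ => hHGint s) fun ω => ?_
          refine (CMSCU.error_le (fun r => F (U r ω)) (fun s => Z s ω) p i t r).trans (le_of_eq ?_)
          simp only [Set.indicator_apply, H, G, 𝒯, Set.mem_ofPred_eq, Pi.one_apply]
      _ = ∑ s ∈ Finset.range t, ((∑ j ∈ Finset.univ.erase i, μ.real (H s j))
            + ∑ T ∈ 𝒯, μ.real (G s T)) := by
          rw [integral_finsetSum _ fun s _ => hHGint s]
          refine Finset.sum_congr rfl fun s _ => ?_
          rw [integral_add (integrable_finsetSum _ fun j _ => hHint s j)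
              (integrable_finsetSum _ fun T _ => hGint s T),
            integral_finsetSum _ fun j _ => hHint s j, integral_finsetSum _ fun T _ => hGint s T,
            Finset.sum_congr rfl fun j _ => integral_indicator_one (hHm s j),
            Finset.sum_congr rfl fun T _ => integral_indicator_one (hGm s T)]
      _ ≤ _ := by
          rw [Finset.sum_add_distrib, Finset.sum_comm (t := 𝒯)]
          refine add_le_add ?_ (Finset.sum_le_sum fun T hT => hGle t T hT)
          refine (Finset.sum_le_card_nsmul _ _ _ fun s _ => ?_).trans_eq
            (by rw [Finset.card_range, nsmul_eq_mul])
          rw [Finset.mul_sum]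
          exact Finset.sum_le_sum fun j hj => hHle s j (Finset.ne_of_mem_erase hj)
  rw [integral_div, div_le_iff₀ ht0, add_mul, div_mul_cancel₀ _ ht0.ne']
  linarith
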